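/- Let $\mathcal{A}$ be an abelian category. The category $\textup{pro-}\mathcal{A}$ has as objects the functors $X : I \to \mathcal{A}$, $s \mapsto X_s$, with $I$ a small cofiltered category, and as morphisms $$\operatorname{Hom}_{\textup{pro-}\mathcal{A}}(X,Y) = \lim_s \operatorname{colim}_t \operatorname{Hom}_{\mathcal{A}}(X_t, Y_s),$$ composed through representatives. Then $\textup{pro-}\mathcal{A}$ is an abelian category, it has all small cofiltered limits, and cofiltered limits are exact in it: for every small cofiltered category $J$, the functor $\lim_J : (\textup{pro-}\mathcal{A})^J \to \textup{pro-}\mathcal{A}$ preserves finite limits and finite colimits; in particular it takes short exact sequences of $J$-indexed diagrams to short exact sequences. -/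

import Mathlib

open CategoryTheory Limits Opposite

universe v u

/-- A pro-object of `C`: a diagram in `C` indexed by a small cofiltered category. -/
structure Pro (C : Type u) [Category.{v} C] : Type (max u (v + 1)) where
  /-- The indexing category. -/
  Index : Type v
  [smallCategory : SmallCategory Index]
  [isCofiltered : IsCofiltered Index]
  /-- The diagram. -/
  diagram : Index ⥤ C

namespace Pro

variable {C : Type u} [Category.{v} C]

instance (X : Pro C) : SmallCategory X.Index := X.smallCategory

instance (X : Pro C) : IsCofiltered X.Index := X.isCofiltered

/-- The functor `c ↦ colim_t Hom_C(X_t, c)`, where `t` runs over the opposite of the index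
category of `X`. A morphism of `C` acts by postcomposition. -/
noncomputable def homTo (X : Pro C) : C ⥤ Type v where
  obj c := colimit (X.diagram.op ⋙ yoneda.obj c)
  map h := colimMap (Functor.whiskerLeft X.diagram.op (yoneda.map h))

/-- The class in `colim_t Hom_C(X_t, c)` of a morphism `X_t ⟶ c`. -/
noncomputable def homMk (X : Pro C) {c : C} (t : X.Index) (f : X.diagram.obj t ⟶ c) :
    X.homTo.obj c :=
  colimit.ι (X.diagram.op ⋙ yoneda.obj c) (op t) f

theorem homTo_map_homMk (X : Pro C) {c d : C} (h : c ⟶ d) (t : X.Index)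
    (f : X.diagram.obj t ⟶ c) : X.homTo.map h (X.homMk t f) = X.homMk t (f ≫ h) :=
  ConcreteCategory.congr_hom
    (ι_colimMap (Functor.whiskerLeft X.diagram.op (yoneda.map h)) (op t)) f

theorem homMk_map_comp (X : Pro C) {c : C} {t t' : X.Index} (φ : t' ⟶ t)
    (f : X.diagram.obj t ⟶ c) : X.homMk t' (X.diagram.map φ ≫ f) = X.homMk t f :=
  ConcreteCategory.congr_hom (colimit.w (X.diagram.op ⋙ yoneda.obj c) φ.op) f

theorem exists_homMk (X : Pro C) {c : C} (x : X.homTo.obj c) :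
    ∃ (t : X.Index) (f : X.diagram.obj t ⟶ c), X.homMk t f = x := by
  obtain ⟨t, f, h⟩ := Types.jointly_surjective' x
  exact ⟨t.unop, f, h⟩

/-- The set of morphisms of pro-objects, `lim_s colim_t Hom_C(X_t, Y_s)`: the compatible
families of elements of the sets `colim_t Hom_C(X_t, Y_s)`. -/
@[ext]
structure Hom (X Y : Pro C) : Type v where
  /-- The component in `colim_t Hom_C(X_t, Y_s)`. -/
  app : ∀ s : Y.Index, X.homTo.obj (Y.diagram.obj s)
  /-- The components are compatible. -/
  compatible : ∀ {s s' : Y.Index} (φ : s ⟶ s'),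
    X.homTo.map (Y.diagram.map φ) (app s) = app s'

/-- The cocone defining `Hom.precomp`. -/
noncomputable def Hom.precompCocone {X Y : Pro C} (f : Hom X Y) (c : C) :
    Cocone (Y.diagram.op ⋙ yoneda.obj c) where
  pt := X.homTo.obj c
  ι :=
    { app := fun s => ↾fun h => X.homTo.map h (f.app s.unop)
      naturality := by
        intro s s' φ
        ext h
        change X.homTo.map (Y.diagram.map φ.unop ≫ h) (f.app s'.unop) =
          X.homTo.map h (f.app s.unop)
        rw [← f.compatible φ.unop, Functor.map_comp]
        rfl }

/-- Precomposition with a morphism `X ⟶ Y` of pro-objects, as a map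
`colim_s Hom_C(Y_s, c) ⟶ colim_t Hom_C(X_t, c)`: if the component of the morphism at `s` is the
class of `k : X_t ⟶ Y_s`, then the class of `h : Y_s ⟶ c` goes to the class of `k ≫ h`. -/
noncomputable def Hom.precomp {X Y : Pro C} (f : Hom X Y) (c : C) :
    Y.homTo.obj c ⟶ X.homTo.obj c :=
  colimit.desc (Y.diagram.op ⋙ yoneda.obj c) (f.precompCocone c)

theorem Hom.precomp_homMk {X Y : Pro C} (f : Hom X Y) {c : C} (s : Y.Index)
    (h : Y.diagram.obj s ⟶ c) : f.precomp c (Y.homMk s h) = X.homTo.map h (f.app s) :=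
  ConcreteCategory.congr_hom (colimit.ι_desc (f.precompCocone c) (op s)) h

theorem Hom.precomp_naturality {X Y : Pro C} (f : Hom X Y) {c d : C} (h : c ⟶ d)
    (y : Y.homTo.obj c) :
    X.homTo.map h (f.precomp c y) = f.precomp d (Y.homTo.map h y) := by
  obtain ⟨s, k, rfl⟩ := Y.exists_homMk y
  rw [homTo_map_homMk, precomp_homMk, precomp_homMk, Functor.map_comp]
  rfl

/-- The identity of a pro-object is represented by the identities of its terms. -/
noncomputable def Hom.id (X : Pro C) : Hom X X where
  app s := X.homMk s (𝟙 _)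
  compatible {s s'} φ := by
    rw [homTo_map_homMk, Category.id_comp, ← X.homMk_map_comp φ (𝟙 _), Category.comp_id]

/-- Composition of morphisms of pro-objects. -/
noncomputable def Hom.comp {X Y Z : Pro C} (f : Hom X Y) (g : Hom Y Z) : Hom X Z where
  app r := f.precomp _ (g.app r)
  compatible φ := by rw [precomp_naturality, g.compatible]

/-- Composition is induced by composition of representatives. -/
theorem Hom.comp_app_eq {X Y Z : Pro C} (f : Hom X Y) (g : Hom Y Z) {r : Z.Index} {s : Y.Index}
    {t : X.Index} (k : X.diagram.obj t ⟶ Y.diagram.obj s) (h : Y.diagram.obj s ⟶ Z.diagram.obj r)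
    (hk : f.app s = X.homMk t k) (hh : g.app r = Y.homMk s h) :
    (f.comp g).app r = X.homMk t (k ≫ h) := by
  change f.precomp _ (g.app r) = _
  rw [hh, precomp_homMk, hk, homTo_map_homMk]

theorem Hom.precomp_id (X : Pro C) (c : C) (x : X.homTo.obj c) : (Hom.id X).precomp c x = x := by
  obtain ⟨t, k, rfl⟩ := X.exists_homMk x
  rw [precomp_homMk]
  change X.homTo.map k (X.homMk t (𝟙 _)) = _
  rw [homTo_map_homMk, Category.id_comp]

theorem Hom.precomp_comp {X Y Z : Pro C} (f : Hom X Y) (g : Hom Y Z) (c : C)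
    (z : Z.homTo.obj c) : (f.comp g).precomp c z = f.precomp c (g.precomp c z) := by
  obtain ⟨r, k, rfl⟩ := Z.exists_homMk z
  rw [precomp_homMk, precomp_homMk, ← precomp_naturality]
  rfl

/-- The category of pro-objects of `C`. -/
noncomputable instance : Category.{v} (Pro C) where
  Hom := Hom
  id := Hom.id
  comp := Hom.comp
  id_comp f := Hom.ext (funext fun _ => Hom.precomp_id _ _ _)
  comp_id {X Y} f := Hom.ext (funext fun s => by
    change f.precomp _ (Y.homMk s (𝟙 _)) = _
    rw [Hom.precomp_homMk, CategoryTheory.Functor.map_id]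
    rfl)
  assoc f g h := Hom.ext (funext fun _ => Hom.precomp_comp f g _ _)

end Pro

/-! Send a pro-object X of `A` to the functor colim_t Hom(X_t, -), an ind-object of `Aᵒᵖ`. By
Yoneda, maps between such functors are, with direction reversed, the families in lim_s colim_t
Hom(X_t, Y_s); hence `Pro.equivalenceOpInd`, and the theorem is dual to statements about
ind-objects. Filtered colimits of ind-objects exist and are exact; `hasExactLimitsOfShape_op`
dualizes the exactness. `Ind.abelian` holds because ind-objects are left exact presheaves, hence
lift to abelian groups, and each morphism comes from a levelwise one. -/

section IndAbelian

variable {C : Type u} [Category.{v} C]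

/-- A filtered colimit of functors preserving finite limits preserves finite limits. -/
theorem preservesFiniteLimits_colimit_of_isFiltered {D : Type*} [Category* D] {I : Type v}
    [SmallCategory I] [IsFiltered I] (G : I ⥤ D ⥤ Type v)
    [∀ i, PreservesFiniteLimits (G.obj i)] : PreservesFiniteLimits (colimit G) := by
  -- The colimit is pointwise, so it factors as `G.flip` followed by `colim` on sets, which commutes
  -- with finite limits as `I` is filtered.
  have : PreservesFiniteLimits G.flip :=
    preservesFiniteLimits_of_evaluation _ fun i =>
      inferInstanceAs (PreservesFiniteLimits (G.obj i))
  have : PreservesFiniteLimits (G.flip ⋙ colim) := comp_preservesFiniteLimits _ _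
  exact preservesFiniteLimits_of_natIso (colimitIsoFlipCompColim G).symm

theorem CategoryTheory.Limits.IsIndObject.preservesFiniteLimits {B : Cᵒᵖ ⥤ Type v}
    (h : IsIndObject B) : PreservesFiniteLimits B := by
  have : ∀ i, PreservesFiniteLimits ((h.presentation.F ⋙ yoneda).obj i) := fun i =>
    inferInstanceAs (PreservesFiniteLimits (yoneda.obj _))
  have := preservesFiniteLimits_colimit_of_isFiltered (h.presentation.F ⋙ yoneda)
  exact preservesFiniteLimits_of_natIso (F := colimit (h.presentation.F ⋙ yoneda))
    ((colimit.isColimit _).coconePointUniqueUpToIso h.presentation.coconeIsColimit)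

variable (C) in
/-- An ind-object, seen as a left exact presheaf. -/
noncomputable def CategoryTheory.Ind.toLeftExactFunctor : Ind C ⥤ (Cᵒᵖ ⥤ₗ Type v) :=
  ObjectProperty.lift _ (Ind.inclusion C) fun X =>
    (leftExactFunctor_iff _).2 X.isIndObject_inclusion_obj.preservesFiniteLimits

/-- Morphisms of ind-objects are the same as morphisms of left exact presheaves. -/
noncomputable def CategoryTheory.Ind.toLeftExactFunctorFullyFaithful :
    (Ind.toLeftExactFunctor C).FullyFaithful :=
  Functor.FullyFaithful.ofCompFaithful (G := ObjectProperty.ι _)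
    (Ind.inclusion.fullyFaithful (C := C))

attribute [local instance] HasFiniteBiproducts.of_hasFiniteCoproducts in
/-- Ind-objects of an additive category with finite colimits form a preadditive category. -/
@[reducible]
noncomputable def CategoryTheory.Ind.preadditive [Preadditive C] [HasFiniteColimits C] :
    Preadditive (Ind C) :=
  .ofFullyFaithful ((Ind.toLeftExactFunctorFullyFaithful (C := C)).comp
    ((AddCommGrpCat.leftExactFunctorForgetEquivalence _).symm.fullyFaithfulFunctor.comp
      (ObjectProperty.fullyFaithfulι _)))

/-- Ind-objects of an abelian category form an abelian category. -/
@[reducible]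
noncomputable def CategoryTheory.Ind.abelian [Abelian C] : Abelian (Ind C) := by
  letI := Ind.preadditive (C := C)
  have : HasFiniteBiproducts (Ind C) := .of_hasFiniteCoproducts
  have {X Y : Ind C} (f : X ⟶ Y) : IsIso (Abelian.coimageImageComparison f) := by
    -- Up to isomorphism `f` is the colimit of a map `φ` of `I`-diagrams in `C`. The comparison for
    -- `φ` is invertible, and `Ind.lim I` preserves it.
    obtain ⟨I, _, _, F, G, φ, ⟨i⟩⟩ := Ind.exists_nonempty_arrow_mk_iso_ind_lim (f := f)
    let i' : Arrow.mk (Abelian.coimageImageComparison f) ≅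
        Arrow.mk (Abelian.coimageImageComparison ((Ind.lim I).map φ)) :=
      Abelian.coimageImageComparisonFunctor.mapIso i
    have := Iso.isIso_hom i'
    rw [Arrow.isIso_iff_isIso_of_isIso i'.hom, Arrow.isIso_iff_isIso_of_isIso
      (Abelian.PreservesCoimageImageComparison.iso (Ind.lim I) φ).inv]
    infer_instance
  exact .ofCoimageImageComparisonIsIso
end IndAbelian

section Opposite
variable {J : Type*} [Category* J] {C : Type*} [Category* C]

/-- Limits in the opposite category are opposites of colimits, functorially. -/
noncomputable def opColimIsoLim [HasColimitsOfShape Jᵒᵖ C] [HasLimitsOfShape J Cᵒᵖ] :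
    (Functor.leftOpRightOpEquiv J C).inverse ⋙ colim.op ≅ (lim : (J ⥤ Cᵒᵖ) ⥤ Cᵒᵖ) :=
  NatIso.ofComponents
    (fun F => (limit.isoLimitCone
      ⟨_, isLimitConeOfCoconeLeftOp F (colimit.isColimit F.leftOp)⟩).symm)
    (fun {F G} f => limit.hom_ext fun j => by
      have h (H : J ⥤ Cᵒᵖ) : (limit.isoLimitCone
          ⟨_, isLimitConeOfCoconeLeftOp H (colimit.isColimit H.leftOp)⟩).inv ≫ limit.π H j =
            (colimit.ι H.leftOp (op j)).op :=
        limit.isoLimitCone_inv_π ⟨_, isLimitConeOfCoconeLeftOp H (colimit.isColimit H.leftOp)⟩ j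
      have hf : lim.map f ≫ limit.π G j = limit.π F j ≫ f.app j := limMap_π f j
      refine (Category.assoc _ _ _).trans ?_
      refine (congrArg (_ ≫ ·) (h G)).trans ?_
      refine Eq.trans ?_ (Category.assoc _ _ _).symm
      refine Eq.trans ?_ (congrArg (_ ≫ ·) hf.symm)
      refine Eq.trans ?_ (Category.assoc _ _ _)
      refine Eq.trans ?_ (congrArg (· ≫ f.app j) (h F).symm)
      exact congrArg Quiver.Hom.op (ι_colimMap (NatTrans.leftOp f) (op j)))

/-- If `Jᵒᵖ`-shaped colimits in `C` are exact, so are `J`-shaped limits in `Cᵒᵖ`. -/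
theorem hasExactLimitsOfShape_op [HasColimitsOfShape Jᵒᵖ C] [HasLimitsOfShape J Cᵒᵖ]
    [HasExactColimitsOfShape Jᵒᵖ C] : HasExactLimitsOfShape J Cᵒᵖ where
  preservesFiniteColimits :=
    have := preservesFiniteColimits_op (colim : (Jᵒᵖ ⥤ C) ⥤ C)
    have := comp_preservesFiniteColimits (Functor.leftOpRightOpEquiv J C).inverse
      (colim : (Jᵒᵖ ⥤ C) ⥤ C).op
    preservesFiniteColimits_of_natIso opColimIsoLim

end Opposite

namespace Pro
variable {C : Type u} [Category.{v} C]

/-- The presheaf `c ↦ colim_t Hom_C(X_t, c)` on `Cᵒᵖ` attached to a pro-object of `C`. -/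
noncomputable def presheaf (X : Pro C) : Cᵒᵖᵒᵖ ⥤ Type v := unopUnop C ⋙ X.homTo

/-- The functor sending a pro-object to the corresponding presheaf. -/
noncomputable def toPresheaf : (Pro C)ᵒᵖ ⥤ Cᵒᵖᵒᵖ ⥤ Type v where
  obj X := X.unop.presheaf
  map f :=
    { app c := Hom.precomp f.unop c.unop.unop
      naturality c d h := by
        ext y
        exact (Hom.precomp_naturality f.unop h.unop.unop y).symm }
  map_id X := by
    ext c x
    exact Hom.precomp_id _ _ x
  map_comp f g := by
    ext c x
    exact Hom.precomp_comp g.unop f.unop _ x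

/-- Morphisms of pro-objects are the same as morphisms of the corresponding presheaves. -/
noncomputable def toPresheafFullyFaithful : (toPresheaf (C := C)).FullyFaithful where
  preimage {X Y} η := Quiver.Hom.op (show Hom Y.unop X.unop from
    -- Yoneda: `η` is determined by its values on the classes of the identities of the terms.
    { app s := η.app (op (op (X.unop.diagram.obj s))) (X.unop.homMk s (𝟙 _))
      compatible {s s'} φ := by
        have := ConcreteCategory.congr_hom (η.naturality (X.unop.diagram.map φ).op.op)
          (X.unop.homMk s (𝟙 _))
        refine this.symm.trans (congrArg (η.app _) ?_)
        exact (Hom.id X.unop).compatible φ })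
  map_preimage {X Y} η := by
    ext c x
    obtain ⟨s, k, rfl⟩ := X.unop.exists_homMk x
    refine (Hom.precomp_homMk _ s k).trans ?_
    refine (ConcreteCategory.congr_hom (η.naturality k.op.op) (X.unop.homMk s (𝟙 _))).symm.trans
      (congrArg (η.app _) ?_)
    exact (homTo_map_homMk _ _ _ _).trans (by rw [Category.id_comp]; rfl)
  preimage_map {X Y} f := Quiver.Hom.unop_inj (Hom.ext (funext fun s => by
    exact (Hom.precomp_homMk f.unop s (𝟙 _)).trans (by
      rw [CategoryTheory.Functor.map_id]; rfl)))

/-- The cocone exhibiting the presheaf of a pro-object as an ind-object of `Cᵒᵖ`. -/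
noncomputable def presheafCocone (X : Pro C) : Cocone (X.diagram.op ⋙ yoneda) where
  pt := X.presheaf
  ι :=
    { app t :=
        { app c := ↾fun f => X.homMk t.unop f.unop
          naturality c d h := by
            ext f
            exact (X.homTo_map_homMk h.unop.unop t.unop f.unop).symm }
      naturality t t' φ := by
        ext c f
        exact X.homMk_map_comp φ.unop f.unop }

/-- The presheaf of a pro-object is the filtered colimit of its terms. -/
noncomputable def isColimitPresheafCocone (X : Pro C) : IsColimit X.presheafCocone :=
  evaluationJointlyReflectsColimits _ fun c =>
    (IsColimit.equivOfNatIsoOfIso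
      (F := (X.diagram.op ⋙ yoneda) ⋙ (evaluation _ _).obj c)
      (G := X.diagram.op ⋙ yoneda.obj c.unop.unop)
      (NatIso.ofComponents (fun t => (opEquiv c.unop (op (X.diagram.obj t.unop))).toIso) (fun f => by ext; rfl))
      (((evaluation _ _).obj c).mapCocone X.presheafCocone)
      (colimit.cocone (X.diagram.op ⋙ yoneda.obj c.unop.unop))
      (Cocone.ext (Iso.refl _) (fun t => by ext; rfl))).symm (colimit.isColimit _)

theorem isIndObject_presheaf (X : Pro C) : IsIndObject X.presheaf :=
  .mk (.ofCocone X.presheafCocone X.isColimitPresheafCocone)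

variable (C) in
/-- The opposite of the category of pro-objects, as presheaves that are ind-objects. -/
noncomputable def toIndObject :
    (Pro C)ᵒᵖ ⥤ ObjectProperty.FullSubcategory (IsIndObject (C := Cᵒᵖ)) :=
  ObjectProperty.lift _ toPresheaf fun X => X.unop.isIndObject_presheaf

/-- Passing to ind-objects is fully faithful. -/
noncomputable def toIndObjectFullyFaithful : (toIndObject C).FullyFaithful :=
  Functor.FullyFaithful.ofCompFaithful (G := ObjectProperty.ι _)
    (toPresheafFullyFaithful (C := C))

instance : (toIndObject C).EssSurj where
  mem_essImage B := by
    obtain ⟨⟨P⟩⟩ := B.property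
    let X : Pro C := { Index := P.Iᵒᵖ, diagram := P.F.leftOp }
    -- The diagram of `X.presheaf` is indexed by `P.Iᵒᵖᵒᵖ`, so the cocone of `P` is reindexed before
    -- comparing colimits.
    let e : X.presheaf ≅ B.obj := X.isColimitPresheafCocone.coconePointUniqueUpToIso
      (P.coconeIsColimit.whiskerEquivalence (opOpEquivalence P.I))
    exact ⟨op X, ⟨(ObjectProperty.fullyFaithfulι _).preimageIso e⟩⟩

instance : (toIndObject C).IsEquivalence where
  faithful := toIndObjectFullyFaithful.faithful
  full := toIndObjectFullyFaithful.full

variable (C) in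
/-- Pro-objects of `C` are the same as ind-objects of `Cᵒᵖ`, up to reversing arrows. -/
noncomputable def equivalenceOpInd : Pro C ≌ (Ind Cᵒᵖ)ᵒᵖ :=
  (opOpEquivalence (Pro C)).symm.trans
    ((toIndObject C).asEquivalence.trans (Ind.equivalence Cᵒᵖ).symm).op

instance : HasCofilteredLimitsOfSize.{v, v} (Pro C) where
  HasLimitsOfShape _ _ _ :=
    Adjunction.hasLimitsOfShape_of_equivalence (equivalenceOpInd C).functor

/-- Dual to exactness of filtered colimits in `Ind Cᵒᵖ`, where finite limits exist because `C` has
finite colimits. -/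
theorem hasExactLimitsOfShape [HasFiniteColimits C] (J : Type v) [SmallCategory J]
    [IsCofiltered J] : HasExactLimitsOfShape J (Pro C) :=
  have : HasExactLimitsOfShape J (Ind Cᵒᵖ)ᵒᵖ := hasExactLimitsOfShape_op
  HasExactLimitsOfShape.of_codomain_equivalence J (equivalenceOpInd C).symm

/-- Pro-objects of an abelian category form an abelian category. -/
@[reducible]
noncomputable def abelian [Abelian C] : Abelian (Pro C) := by
  letI := Ind.abelian (C := Cᵒᵖ)
  letI : Preadditive (Pro C) := .ofFullyFaithful (equivalenceOpInd C).fullyFaithfulFunctor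
  have : HasFiniteProducts (Pro C) :=
    ⟨fun _ => Adjunction.hasLimitsOfShape_of_equivalence (equivalenceOpInd C).functor⟩
  exact abelianOfEquivalence (equivalenceOpInd C).functor

end Pro

theorem theorem7p1 (A : Type u) [Category.{v} A] [Abelian A] :
    ∃ (_ : Abelian (Pro A)) (_ : HasCofilteredLimitsOfSize.{v, v} (Pro A)),
      ∀ (J : Type v) [SmallCategory J] [IsCofiltered J],
        PreservesFiniteLimits (lim : (J ⥤ Pro A) ⥤ Pro A) ∧
        PreservesFiniteColimits (lim : (J ⥤ Pro A) ⥤ Pro A) ∧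
        ∀ S : ShortComplex (J ⥤ Pro A), S.ShortExact → (S.map lim).ShortExact := by
  refine ⟨Pro.abelian, inferInstance, fun J _ _ => ?_⟩
  let _ : Abelian (Pro A) := Pro.abelian
  have := Pro.hasExactLimitsOfShape (C := A) J
  exact ⟨inferInstance, inferInstance, fun S hS => hS.map_of_exact lim⟩
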